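/- For positive integers $s,t$, a homothetic copy of $\{1,1+s,1+s+t\}$ is a set of the form $\{x,\,x+ys,\,x+ys+yt\}$ with $x,y$ positive integers. Let $f(s,t)$ be the smallest positive integer $N$ such that every $2$-coloring of $\{1,2,\dots,N\}$ has a monochromatic homothetic copy of $\{1,1+s,1+s+t\}$. Then $f$ is determined as follows. (i) If $s,t$ are positive integers such that $(s,t)$ is of neither of the forms $(4mu,u)$, $(u,4mu)$ with $m,u$ positive integers, then $f(s,t)=4(s+t)+1$. (ii) For all positive integers $m,t$, $f(4mt,t)=f(t,4mt)=4(4mt+t)-t+1$. -/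

import Mathlib

/-- `A` is a homothetic copy of `{1, 1 + s, 1 + s + t}`, that is, a set of the form
`{x, x + y s, x + y s + y t}` with `x` and `y` positive integers. -/
def IsHomotheticCopy (s t : ℕ) (A : Set ℕ) : Prop :=
  ∃ x y : ℕ, 0 < x ∧ 0 < y ∧ A = {x, x + y * s, x + y * s + y * t}

/-- Every `2`-coloring of `[1, N] = {1, …, N}` has a monochromatic homothetic copy of
`{1, 1 + s, 1 + s + t}`. -/
def ForcesMonochromaticCopy (s t N : ℕ) : Prop :=
  ∀ C : Set.Icc 1 N → Fin 2, ∃ A : Set (Set.Icc 1 N),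
    IsHomotheticCopy s t (Subtype.val '' A) ∧ ∃ c : Fin 2, ∀ a ∈ A, C a = c

/-- `homotheticVdW s t` is the smallest positive integer `N` such that every `2`-coloring of
`[1, N]` has a monochromatic homothetic copy of `{1, 1 + s, 1 + s + t}`. (The infimum of the
empty set would be `0`, so a positive value is always an attained minimum.) -/
noncomputable def homotheticVdW (s t : ℕ) : ℕ :=
  sInf {N : ℕ | 0 < N ∧ ForcesMonochromaticCopy s t N}

/-! Upper bound (`not_avoidsCopies`): the points `i s + j t` with `0 ≤ j ≤ i ≤ 4` form a triangular
grid whose similarly oriented triangles are homothetic copies, and every 2-colouring of it has a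
monochromatic one. This is sharp unless one of `s, t` is a multiple of four times the other.
Dilation reduces to coprime `s, t`; there parity, period-4 or "phase" colourings
(`exists_avoidsCopies_of_coprime`) avoid copies on `4 (s + t)` points. The exceptional pairs reduce
to `(4m, 1)`. An explicit colouring reaches `4 (4m + 1) - 1` points. One more point is impossible:
write the integers in four overlapping rows, each starting `4m` after the previous one. Copies
become triangles in at most four adjacent columns, so a sliding block of four columns has finitely
many states, and no admissible sequence of blocks ends consistently with the overlap. -/

/-- The colouring `C` has no monochromatic set `{x, x + y s, x + y s + y t}`, `y > 0`,
inside `{0, …, L - 1}`. -/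
def AvoidsCopies (s t L : ℕ) (C : ℕ → Bool) : Prop :=
  ∀ x y : ℕ, 0 < y → x + y * (s + t) < L →
    ¬ (C x = C (x + y * s) ∧ C x = C (x + y * (s + t)))

theorem forcesMonochromaticCopy_iff (s t N : ℕ) :
    ForcesMonochromaticCopy s t N ↔ ∀ C : ℕ → Bool, ¬ AvoidsCopies s t N C := by
  constructor
  · intro h C hC
    obtain ⟨A, ⟨x, y, hx, hy, hA⟩, c, hc⟩ :=
      h (fun a => if C (a.1 - 1) then 1 else 0)
    have key : ∀ z ∈ ({x, x + y * s, x + y * s + y * t} : Set ℕ),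
        z ≤ N ∧ (if C (z - 1) then (1 : Fin 2) else 0) = c := by
      intro z hz
      rw [← hA] at hz
      obtain ⟨a, ha, rfl⟩ := hz
      exact ⟨a.2.2, hc a ha⟩
    obtain ⟨-, h1⟩ := key x (by simp)
    obtain ⟨-, h2⟩ := key (x + y * s) (by simp)
    obtain ⟨h3, h3'⟩ := key (x + y * s + y * t) (by simp)
    refine hC (x - 1) y hy (by rw [mul_add]; omega) ⟨?_, ?_⟩
    · rw [show x - 1 + y * s = x + y * s - 1 by omega]
      rw [← h2] at h1
      revert h1
      cases C (x - 1) <;> cases C (x + y * s - 1) <;> simp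
    · rw [show x - 1 + y * (s + t) = x + y * s + y * t - 1 by rw [mul_add]; omega]
      rw [← h3'] at h1
      revert h1
      cases C (x - 1) <;> cases C (x + y * s + y * t - 1) <;> simp
  · intro h C
    have hne := h (fun a => if ha : a + 1 ∈ Set.Icc 1 N then decide (C ⟨a + 1, ha⟩ = 0) else true)
    simp only [AvoidsCopies, not_forall, not_not] at hne
    obtain ⟨x, y, hy, hN, h1, h2⟩ := hne
    have hst : y * (s + t) = y * s + y * t := mul_add _ _ _
    have m0 : x + 1 ∈ Set.Icc 1 N := ⟨by omega, by omega⟩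
    have m1 : x + y * s + 1 ∈ Set.Icc 1 N := ⟨by omega, by omega⟩
    have m2 : x + y * (s + t) + 1 ∈ Set.Icc 1 N := ⟨by omega, by omega⟩
    rw [dif_pos m0, dif_pos m1] at h1
    rw [dif_pos m0, dif_pos m2] at h2
    have aux : ∀ a b : Fin 2, decide (a = 0) = decide (b = 0) → b = a := by decide
    refine ⟨{⟨x + 1, m0⟩, ⟨x + y * s + 1, m1⟩, ⟨x + y * (s + t) + 1, m2⟩},
      ⟨x + 1, y, by omega, hy, ?_⟩, C ⟨x + 1, m0⟩, ?_⟩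
    · simp only [Set.image_insert_eq, Set.image_singleton]
      rw [show x + y * s + 1 = x + 1 + y * s by omega,
        show x + y * (s + t) + 1 = x + 1 + y * s + y * t by omega]
    · rintro a (rfl | rfl | rfl)
      · rfl
      · exact aux _ _ h1
      · exact aux _ _ h2

/-! ### Restriction, reflection and scaling of avoiding colourings. -/

theorem AvoidsCopies.mono {s t L M : ℕ} {C : ℕ → Bool} (h : AvoidsCopies s t M C) (hL : L ≤ M) :
    AvoidsCopies s t L C :=
  fun x y hy hx => h x y hy (hx.trans_le hL)

theorem AvoidsCopies.reflect {s t L : ℕ} {C : ℕ → Bool} (h : AvoidsCopies s t L C) :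
    AvoidsCopies t s L (fun x => C (L - 1 - x)) := by
  intro x y hy hx ⟨h1, h2⟩
  have e1 : y * (s + t) = y * s + y * t := mul_add _ _ _
  have e2 : y * (t + s) = y * t + y * s := mul_add _ _ _
  refine h (L - 1 - (x + y * (t + s))) y hy (by omega) ⟨?_, ?_⟩
  · rw [show L - 1 - (x + y * (t + s)) + y * s = L - 1 - (x + y * t) by omega]
    exact h2.symm.trans h1
  · rw [show L - 1 - (x + y * (t + s)) + y * (s + t) = L - 1 - x by omega]
    exact h2.symm

theorem AvoidsCopies.dilate {s t L g : ℕ} {C : ℕ → Bool} (hg : 0 < g) (h : AvoidsCopies s t L C) :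
    AvoidsCopies (g * s) (g * t) (g * L) (fun x => C (x / g)) := by
  intro x y hy hx ⟨h1, h2⟩
  have d : ∀ z, (x + y * (g * z)) / g = x / g + y * z := fun z => by
    rw [mul_left_comm, Nat.add_mul_div_left _ _ hg]
  rw [← mul_add] at h2 hx
  simp only [d] at h1 h2
  refine h (x / g) y hy ?_ ⟨h1, h2⟩
  rw [← d]
  exact Nat.div_lt_of_lt_mul hx

/-- The `L + 1` multiples `0, g, …, g L` already fit into `g L + 1` points; this accounts for the
`-t` in the exceptional value. -/
theorem AvoidsCopies.contract {s t L g : ℕ} {C : ℕ → Bool}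
    (h : AvoidsCopies (g * s) (g * t) (g * L + 1) C) :
    AvoidsCopies s t (L + 1) (fun x => C (g * x)) := by
  intro x y hy hx ⟨h1, h2⟩
  refine h (g * x) y hy ?_ ⟨?_, ?_⟩
  · have := Nat.mul_le_mul_left g (Nat.le_of_lt_succ hx)
    calc g * x + y * (g * s + g * t) = g * (x + y * (s + t)) := by ring
      _ < _ := by omega
  · rw [show g * x + y * (g * s) = g * (x + y * s) by ring]; exact h1
  · rw [show g * x + y * (g * s + g * t) = g * (x + y * (s + t)) by ring]; exact h2

theorem homotheticVdW_eq {s t M : ℕ} (hup : ∀ C, ¬ AvoidsCopies s t (M + 1) C)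
    (hlow : ∃ C, AvoidsCopies s t M C) : homotheticVdW s t = M + 1 := by
  refine IsLeast.csInf_eq ⟨⟨M.succ_pos, (forcesMonochromaticCopy_iff s t _).2 hup⟩, ?_⟩
  rintro N ⟨-, hN⟩
  obtain ⟨C, hC⟩ := hlow
  by_contra hlt
  exact (forcesMonochromaticCopy_iff s t N).1 hN C (hC.mono (by omega))

/-! ### The general upper bound. -/

set_option synthInstance.maxHeartbeats 400000 in
set_option synthInstance.maxSize 2000 in
/-- The map `(i, j) ↦ i s + j t` carries a triangular grid with five points on a side
into `{0, …, 4 (s + t)}`. -/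
theorem not_avoidsCopies (s t : ℕ) (C : ℕ → Bool) : ¬ AvoidsCopies s t (4 * (s + t) + 1) C := by
  intro h
  have tri : ∀ i j y : ℕ, 0 < y → i + y ≤ 4 → j ≤ i →
      ¬ (C (i * s + j * t) = C ((i + y) * s + j * t) ∧
        C (i * s + j * t) = C ((i + y) * s + (j + y) * t)) := by
    rintro i j y hy hi hj ⟨h1, h2⟩
    refine h (i * s + j * t) y hy ?_ ⟨?_, ?_⟩
    · have a1 := Nat.mul_le_mul_right s hi
      have a2 := Nat.mul_le_mul_right t ((Nat.add_le_add_right hj y).trans hi)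
      calc i * s + j * t + y * (s + t) = (i + y) * s + (j + y) * t := by ring
        _ < _ := by omega
    · rw [h1]; congr 1; ring
    · rw [h2]; congr 1; ring
  -- The letters `a, …, o` list the grid row by row. Each triangle condition stands soon after its
  -- last vertex is quantified, so that the search is pruned early.
  have key : ∀ a b c : Bool, ¬ (a = b ∧ a = c) → ∀ d f : Bool, ¬ (a = d ∧ a = f) →
      ∀ e : Bool, ¬ (b = d ∧ b = e) → ¬ (c = e ∧ c = f) →
      ∀ g j : Bool, ¬ (a = g ∧ a = j) → ∀ i : Bool, ¬ (f = i ∧ f = j) → ¬ (b = g ∧ b = i) →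
      ∀ h : Bool, ¬ (d = g ∧ d = h) → ¬ (e = h ∧ e = i) → ¬ (c = h ∧ c = j) →
      ∀ k o : Bool, ¬ (a = k ∧ a = o) → ∀ n : Bool, ¬ (j = n ∧ j = o) → ¬ (b = k ∧ b = n) →
      ∀ m : Bool, ¬ (d = k ∧ d = m) → ¬ (i = m ∧ i = n) → ¬ (f = m ∧ f = o) →
      ∀ l : Bool, ¬ (c = l ∧ c = o) → ¬ (e = l ∧ e = n) → ¬ (g = k ∧ g = l) →
      ¬ (h = l ∧ h = m) → False := by decide +kernel
  exact key _ _ _ (tri 0 0 1 (by simp) (by simp) (by simp)) _ _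
    (tri 0 0 2 (by simp) (by simp) (by simp)) _ (tri 1 0 1 (by simp) (by simp) (by simp))
    (tri 1 1 1 (by simp) (by simp) (by simp)) _ _ (tri 0 0 3 (by simp) (by simp) (by simp)) _
    (tri 2 2 1 (by simp) (by simp) (by simp)) (tri 1 0 2 (by simp) (by simp) (by simp)) _
    (tri 2 0 1 (by simp) (by simp) (by simp)) (tri 2 1 1 (by simp) (by simp) (by simp))
    (tri 1 1 2 (by simp) (by simp) (by simp)) _ _ (tri 0 0 4 (by simp) (by simp) (by simp)) _
    (tri 3 3 1 (by simp) (by simp) (by simp)) (tri 1 0 3 (by simp) (by simp) (by simp)) _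
    (tri 2 0 2 (by simp) (by simp) (by simp)) (tri 3 2 1 (by simp) (by simp) (by simp))
    (tri 2 2 2 (by simp) (by simp) (by simp)) _ (tri 1 1 3 (by simp) (by simp) (by simp))
    (tri 2 1 2 (by simp) (by simp) (by simp)) (tri 3 0 1 (by simp) (by simp) (by simp))
    (tri 3 1 1 (by simp) (by simp) (by simp))

/-! ### Colourings of `4 (s + t)` points. -/

/-- A function `V` that grows by `1` along `n = s + t` and drops by `1` or `2` along `s`, modulo
`4`, gives a colouring of `4 n` integers: the colour of `x` records whether `V x` is `0` or `1`
modulo `4`. -/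
theorem avoidsCopies_of_phase {s t n : ℕ} (hst : s + t = n) (V : ℤ → ℤ)
    (hn : ∀ x : ℤ, (V (x + n) - V x) % 4 = 1)
    (hs : ∀ x : ℤ, (V (x + s) - V x) % 4 = 3 ∨ (V (x + s) - V x) % 4 = 2)
    (h3 : ∀ x : ℤ, 0 ≤ x → x < n → V x % 2 = 1 →
      (V (x + s + s + s) - V x) % 4 = 1 ∨ (V (x + s + s + s) - V x) % 4 = 2) :
    AvoidsCopies s t (4 * n) (fun x => decide (V x % 4 < 2)) := by
  subst hst
  intro x y hy hx ⟨h1, h2⟩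
  have hy4 : y < 4 := lt_of_mul_lt_mul_right ((Nat.le_add_left _ _).trans_lt hx) (Nat.zero_le _)
  simp only [decide_eq_decide] at h1 h2
  have n1 := hn x
  have n2 := hn (x + (s + t : ℕ))
  have n3 := hn (x + (s + t : ℕ) + (s + t : ℕ))
  have s1 := hs x
  -- For `y = 1`, `V + 1` has the colour of `V` only if `V` is even, and then `V - 1` and `V - 2`
  -- have the other colour. For `y = 2`, `V + 2` always has the other colour. For `y = 3`, `V + 3`
  -- has the colour of `V` only if `V` is odd, and `h3` applies.
  interval_cases y
  · rw [show ((x + 1 * s : ℕ) : ℤ) = x + s by push_cast; ring] at h1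
    rw [show ((x + 1 * (s + t) : ℕ) : ℤ) = x + (s + t : ℕ) by push_cast; ring] at h2
    omega
  · rw [show ((x + 2 * (s + t) : ℕ) : ℤ) = x + (s + t : ℕ) + (s + t : ℕ) by push_cast; ring] at h2
    omega
  · rw [show ((x + 3 * s : ℕ) : ℤ) = x + s + s + s by push_cast; ring] at h1
    rw [show ((x + 3 * (s + t) : ℕ) : ℤ) = x + (s + t : ℕ) + (s + t : ℕ) + (s + t : ℕ) by
      push_cast; ring] at h2
    have := h3 x (by omega) (by omega)
    omega

theorem exists_avoidsCopies_of_even {s t : ℕ} (hs : s % 2 = 1) (ht : t % 2 = 1) :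
    ∃ C, AvoidsCopies s t (4 * (s + t)) C := by
  refine ⟨fun x => decide ((x + if x < 2 * (s + t) then 0 else 1) % 2 = 0), ?_⟩
  intro x y hy hx ⟨h1, h2⟩
  have hy4 : y < 4 := lt_of_mul_lt_mul_right ((Nat.le_add_left _ _).trans_lt hx) (Nat.zero_le _)
  simp only [decide_eq_decide] at h1 h2
  interval_cases y <;> split_ifs at h1 h2 <;> omega

theorem exists_avoidsCopies_of_mod_four {s t : ℕ} (hs : s % 4 = 2) (ht : t % 2 = 1) :
    ∃ C, AvoidsCopies s t (4 * (s + t)) C := by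
  refine ⟨fun x => decide (x % 4 < 2), ?_⟩
  intro x y hy hx ⟨h1, h2⟩
  have hy4 : y < 4 := lt_of_mul_lt_mul_right ((Nat.le_add_left _ _).trans_lt hx) (Nat.zero_le _)
  simp only [decide_eq_decide] at h1 h2
  interval_cases y <;> omega

/-- Modulo `n = s + t`, adding `s` runs through all residues in one cycle. Along it `V` changes by
the row carry (`0` or `1`), minus `2`, plus a jump of `A`. Two jumps per cycle make `V` consistent
modulo `4`, since `-2n + 2` is divisible by `4` for odd `n`. The jumps are placed where the carry is
`0`, so the change is always `-1` or `-2`. -/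
theorem exists_avoidsCopies_of_coprime {s t : ℕ} (hco : s.Coprime t) (hodd : (s + t) % 2 = 1)
    (ht : 2 ≤ t) (hts : t < s) : ∃ C, AvoidsCopies s t (4 * (s + t)) C := by
  obtain ⟨n, hn⟩ : ∃ n, s + t = n := ⟨_, rfl⟩
  obtain ⟨u, l, hul⟩ : ∃ u l : ℤ, u * s = 1 + n * l := by
    have h : IsCoprime (s : ℤ) n := by
      rw [Nat.isCoprime_iff_coprime, ← hn]; simpa using hco
    obtain ⟨a, b, hab⟩ := h
    exact ⟨a, -b, by linear_combination hab⟩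
  -- `d` is the least integer with `t d > s`. The cycle starts at the residue `r = t d - 1` and, as
  -- `s ≡ -t`, first descends by `t` to `t - 1` at index `d - 1`.
  obtain ⟨d, hd⟩ : ∃ d : ℤ, d = s / t + 1 := ⟨_, rfl⟩
  have hdt : s < t * d ∧ t * d ≤ s + t := by
    have h1 := Int.mul_ediv_add_emod s t
    have h2 := Int.emod_nonneg (s : ℤ) (b := t) (by omega)
    have h3 := Int.emod_lt_of_pos (s : ℤ) (b := t) (by omega)
    rw [hd, mul_add]
    constructor <;> linarith
  have hd0 : 0 < d := by
    have := Int.ediv_nonneg (a := s) (b := t) (by omega) (by omega)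
    omega
  have hdn : d < n := by nlinarith
  obtain ⟨r, hr⟩ : ∃ r : ℤ, r = t * d - 1 := ⟨_, rfl⟩
  obtain ⟨i, hi⟩ : ∃ i : ℤ → ℤ, ∀ x, i x = u * (x - r) := ⟨_, fun _ => rfl⟩
  -- `A` goes up by `1` on entering each index congruent to `0` or `d` modulo `n`.
  obtain ⟨A, hA⟩ : ∃ A : ℤ → ℤ, ∀ k, A k = 1 + k / n + (k + n - d) / n := ⟨_, fun _ => rfl⟩
  have hn0 : (0 : ℤ) < n := by omega
  have hAn : ∀ k q, A (k + n * q) = A k + 2 * q := fun k q => by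
    rw [hA, hA, show k + n * q + n - d = k + n - d + n * q by ring,
      Int.add_mul_ediv_left _ _ hn0.ne', Int.add_mul_ediv_left _ _ hn0.ne']
    ring
  have hA0 : ∀ k, 0 ≤ k → k < d → A k = 1 := fun k h0 h1 => by
    rw [hA, Int.ediv_eq_zero_of_lt h0 (by omega), Int.ediv_eq_zero_of_lt (by omega) (by omega)]
    rfl
  have hA1 : ∀ k, d ≤ k → k < n → A k = 2 := fun k h0 h1 => by
    rw [hA, Int.ediv_eq_zero_of_lt (by omega) h1,
      show k + n - d = k - d + n * 1 by ring, Int.add_mul_ediv_left _ _ hn0.ne',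
      Int.ediv_eq_zero_of_lt (by omega) (by omega)]
    rfl
  -- the residue of `x` in terms of the residue of `i x`
  have hres : ∀ x, ∃ q, x = r + s * (i x % n) + n * q := fun x => by
    have := Int.mul_ediv_add_emod (i x) n
    refine ⟨s * (i x / n) - l * (x - r), ?_⟩
    have h2 := hi x
    linear_combination -(x - r) * hul - s * h2 - s * this
  have hA2 : ∀ k : ℤ, 0 ≤ k → k < n → k ≠ d - 1 → k ≠ n - 1 → A (k + 1) = A k := fun k h0 h1 h2 h3 => by
    rcases lt_or_ge k d with h | h
    · rw [hA0 _ h0 h, hA0 _ (by omega) (by omega)]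
    · rw [hA1 _ h h1, hA1 _ (by omega) (by omega)]
  have hmod : ∀ k, A k = A (k % n) + 2 * (k / n) := fun k => by
    conv_lhs => rw [← Int.emod_add_mul_ediv k n, hAn]
  have hstep : ∀ k, A (k + 1) - A k = A (k % n + 1) - A (k % n) := fun k => by
    have : k + 1 = k % n + 1 + n * (k / n) := by
      linear_combination -Int.emod_add_mul_ediv k n
    rw [this, hAn, hmod k]
    ring
  obtain ⟨V, hV⟩ : ∃ V : ℤ → ℤ, ∀ x, V x = x / n - 2 * i x + A (i x) := ⟨_, fun _ => rfl⟩
  have hVs : ∀ x, (V (x + s) - V x) % 4 =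
      ((x + s) / n - x / n - 2 + (A (i x % n + 1) - A (i x % n))) % 4 := fun x => by
    have e : i (x + s) = i x + 1 + n * l := by
      rw [hi, hi]; linear_combination hul
    obtain ⟨q, hq⟩ : ∃ q, (n : ℤ) = 2 * q + 1 := ⟨n / 2, by omega⟩
    have : V (x + s) - V x = ((x + s) / n - x / n - 2 + (A (i x % n + 1) - A (i x % n)))
        + 4 * (-q * l) := by
      rw [← hstep, hV, hV, e, hAn]
      linear_combination -2 * l * hq
    rw [this, Int.add_mul_emod_self_left]
  -- a jump of `A` happens only where `x + s` stays in the same row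
  have hsmall : ∀ x : ℤ, x % n < t → (x + s) / n = x / n := fun x hx => by
    have h := Int.emod_add_mul_ediv x n
    have h0 := Int.emod_nonneg x hn0.ne'
    rw [show x + s = x % n + s + n * (x / n) by linear_combination -h,
      Int.add_mul_ediv_left _ _ hn0.ne', Int.ediv_eq_zero_of_lt (by omega) (by omega), zero_add]
  have hlarge : ∀ x : ℤ, t ≤ x % n → (x + s) / n = x / n + 1 := fun x hx => by
    have h := Int.emod_add_mul_ediv x n
    have h0 := Int.emod_lt_of_pos x hn0
    rw [show x + s = x % n + s - n + n * (x / n + 1) by linear_combination -h,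
      Int.add_mul_ediv_left _ _ hn0.ne', Int.ediv_eq_zero_of_lt (by omega) (by omega), zero_add]
  have hemod : ∀ x a q : ℤ, x = a + n * q → 0 ≤ a → a < n → x % n = a := fun x a q h h0 h1 => by
    rw [h, Int.add_mul_emod_self_left, Int.emod_eq_of_lt h0 h1]
  have hlast : ∀ x : ℤ, i x % n = n - 1 → x % n = t * d - 1 - s := fun x hx => by
    obtain ⟨q, hq⟩ := hres x
    rw [hx] at hq
    refine hemod x _ (s + q) ?_ (by omega) (by omega)
    linear_combination hq + hr
  have hcol : ∀ x : ℤ, i x % n = d - 1 → x % n = t - 1 := fun x hx => by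
    obtain ⟨q, hq⟩ := hres x
    rw [hx] at hq
    refine hemod x _ (d - 1 + q) ?_ (by omega) (by omega)
    have hn' : (s : ℤ) + t = n := by exact_mod_cast hn
    linear_combination hq + hr + (d - 1) * hn'
  have hcol' : ∀ x : ℤ, x % n = t - 1 → i x % n = d - 1 := fun x hx => by
    have h := Int.emod_add_mul_ediv x n
    have hn' : (s : ℤ) + t = n := by exact_mod_cast hn
    refine hemod _ _ (u * (x / n) + l * (d - 1) - u * (d - 1)) ?_ (by omega) (by omega)
    rw [hi]
    linear_combination (d - 1) * hul - u * h + u * hx - u * hr - u * (d - 1) * hn'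
  have hjump : ∀ k : ℤ, 0 ≤ k → k < n → k = d - 1 ∨ k = n - 1 → A (k + 1) - A k = 1 := by
    rintro k h0 h1 (rfl | rfl)
    · rw [hA0 _ h0 (by omega), hA1 _ (by omega) (by omega)]; rfl
    · rw [show (n : ℤ) - 1 + 1 = 0 + n * 1 by ring, hAn, hA0 _ le_rfl hd0,
        hA1 _ (by omega) (by omega)]
      rfl
  have hdown : ∀ x : ℤ, (t : ℤ) - 1 ≤ x % n → (V (x + s) - V x) % 4 = 3 := fun x hx => by
    have h0 := Int.emod_nonneg (i x) hn0.ne'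
    have h1 := Int.emod_lt_of_pos (i x) hn0
    rw [hVs]
    rcases hx.eq_or_lt with h | h
    · rw [hsmall x (by omega), hjump _ h0 h1 (Or.inl (hcol' x h.symm))]
      omega
    · rw [hlarge x (by omega), hA2 _ h0 h1 (fun h => by have := hcol x h; omega)
        (fun h => by have := hlast x h; omega)]
      omega
  rw [hn]
  refine ⟨_, avoidsCopies_of_phase hn V ?_ ?_ ?_⟩
  · intro x
    obtain ⟨q, hq⟩ : ∃ q, (n : ℤ) = 2 * q + 1 := ⟨n / 2, by omega⟩
    have e : i (x + n) = i x + n * u := by rw [hi, hi]; ring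
    have e' : (x + n) / (n : ℤ) = x / n + 1 := Int.add_ediv_of_dvd_right (dvd_refl _) |>.trans
      (by rw [Int.ediv_self hn0.ne'])
    have : V (x + n) - V x = 1 + 4 * (-q * u) := by
      rw [hV, hV, e, e', hAn]
      linear_combination -2 * u * hq
    rw [this, Int.add_mul_emod_self_left]
    rfl
  · intro x
    rcases lt_or_ge (x % n) t with h | h
    · have h0 := Int.emod_nonneg (i x) hn0.ne'
      have h1 := Int.emod_lt_of_pos (i x) hn0
      by_cases hk : i x % n = d - 1 ∨ i x % n = n - 1
      · rw [hVs, hsmall x h, hjump _ h0 h1 hk]; omega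
      · rw [hVs, hsmall x h, hA2 _ h0 h1 (by tauto) (by tauto)]; omega
    · exact Or.inl (hdown x (by omega))
  -- In row `0` an odd `V x` forces `A (i x)` odd, hence `x = t j - 1` with `1 ≤ j ≤ d`. Then `x`,
  -- `x + s` and `x + 2 s` all have residue at least `t - 1`, so `V` drops by exactly `1` three
  -- times, and `-3 ≡ 1`.
  · intro x hx0 hxn hodd
    have hx : x % n = x := Int.emod_eq_of_lt hx0 hxn
    have h0 := Int.emod_nonneg (i x) hn0.ne'
    have h1 := Int.emod_lt_of_pos (i x) hn0
    have hid : i x % n < d := by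
      by_contra! h
      rw [hV, hmod, hA1 _ h h1, Int.ediv_eq_zero_of_lt hx0 hxn] at hodd
      omega
    obtain ⟨j, hj⟩ : ∃ j, j = d - i x % n := ⟨_, rfl⟩
    have hxj : x = t * j - 1 := by
      obtain ⟨q, hq⟩ := hres x
      have hn' : (s : ℤ) + t = n := by exact_mod_cast hn
      have hjd : (t : ℤ) * j ≤ t * d := by
        apply mul_le_mul_of_nonneg_left _ (by omega); omega
      have hj0 : 0 < (t : ℤ) * j := mul_pos (by omega) (by omega)
      rw [← hx]
      refine hemod x _ (i x % n + q) ?_ (by omega) (by omega)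
      rw [hj]
      linear_combination hq + hr + (i x % n) * hn'
    have hcases : x = t - 1 ∨ x = 2 * t - 1 ∨ 3 * t - 1 ≤ x := by
      have : j = 1 ∨ j = 2 ∨ 3 ≤ j := by omega
      rcases this with rfl | rfl | h
      · left; rw [hxj]; ring
      · right; left; rw [hxj]; ring
      · right; right
        have := mul_le_mul_of_nonneg_left h (Int.natCast_nonneg t)
        linarith
    have hn' : (s : ℤ) + t = n := by exact_mod_cast hn
    have d1 : (t : ℤ) - 1 ≤ x % n := by omega
    have d2 : (t : ℤ) - 1 ≤ (x + s) % n := by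
      rcases hcases with h | h
      · rw [hemod (x + s) (x + s) 0 (by ring) (by omega) (by omega)]; omega
      · rw [hemod (x + s) (x - t) 1 (by linarith) (by omega) (by omega)]; omega
    have d3 : (t : ℤ) - 1 ≤ (x + s + s) % n := by
      rcases hcases with h | h | h
      · rw [hemod (x + s + s) (x + s - t) 1 (by linarith) (by omega) (by omega)]; omega
      · rw [hemod (x + s + s) (x + s - t) 1 (by linarith) (by omega) (by omega)]; omega
      · rw [hemod (x + s + s) (x - 2 * t) 2 (by linarith) (by omega) (by omega)]; omega
    have := hdown _ d1
    have := hdown _ d2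
    have := hdown _ d3
    omega

/-! ### The lower bound for the pair `(4m, 1)`. -/

/-- With rows of length `4m + 1`, the parity of `k + ⌊(c + 1) / 2⌋` at row `k`, column `c` fails
only for `y = 2`, `c = 1`, where the middle point is the last cell of row `1` or `2`. Flipping these
two cells repairs this and would do harm only through the last cell of row `3`, which is left out.
-/
theorem exists_avoidsCopies_four_mul_one {m : ℕ} (hm : 0 < m) :
    ∃ C, AvoidsCopies (4 * m) 1 (4 * (4 * m + 1) - 1) C := by
  refine ⟨fun x => decide (
    ((x / (4 * m + 1) + (x % (4 * m + 1) + 1) / 2 +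
      if x = 2 * (4 * m + 1) - 1 ∨ x = 3 * (4 * m + 1) - 1 then 1 else 0) % 2 = 0)), ?_⟩
  intro x y hy hx ⟨h1, h2⟩
  have hy4 : y < 4 := lt_of_mul_lt_mul_right (a := 4 * m + 1) (by omega) (Nat.zero_le _)
  simp only [decide_eq_decide] at h1 h2
  obtain ⟨k, c, hc, rfl⟩ : ∃ k c, c < 4 * m + 1 ∧ x = (4 * m + 1) * k + c :=
    ⟨x / (4 * m + 1), x % (4 * m + 1), Nat.mod_lt _ (by omega), (Nat.div_add_mod _ _).symm⟩
  have hk : k + y < 4 := by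
    refine lt_of_mul_lt_mul_left (a := 4 * m + 1) ?_ (Nat.zero_le _)
    rw [mul_add, mul_comm _ y]; omega
  have hk3 : k < 3 := by omega
  have dm : ∀ q r, r < 4 * m + 1 → ((4 * m + 1) * q + r) / (4 * m + 1) = q ∧
      ((4 * m + 1) * q + r) % (4 * m + 1) = r := fun q r hr => by
    rw [Nat.mul_add_div (by omega), Nat.div_eq_of_lt hr, Nat.mul_add_mod, Nat.mod_eq_of_lt hr]
    simp
  have e2 : (4 * m + 1) * k + c + y * (4 * m + 1) = (4 * m + 1) * (k + y) + c := by ring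
  rw [e2, (dm _ _ hc).1, (dm _ _ hc).2, (dm _ _ hc).1, (dm _ _ hc).2] at h2
  rw [(dm _ _ hc).1, (dm _ _ hc).2] at h1
  -- Since `4m y = (4m + 1) y - y`, the middle point lies `y` columns left of the third one, one row
  -- earlier if `c < y`.
  rcases lt_or_ge c y with hcy | hcy
  · have e1 : (4 * m + 1) * k + c + y * (4 * m) =
        (4 * m + 1) * (k + y - 1) + (c + (4 * m + 1) - y) := by
      obtain ⟨y, rfl⟩ := Nat.exists_eq_add_of_le hy
      rw [show k + (0 + 1 + y) - 1 = k + y by omega,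
        show c + (4 * m + 1) - (0 + 1 + y) = c + 4 * m - y by omega]
      zify [show y ≤ c + 4 * m by omega]
      ring
    rw [e1, (dm _ _ (by omega)).1, (dm _ _ (by omega)).2] at h1
    rw [e2] at hx
    interval_cases y <;> interval_cases k <;> split_ifs at h1 h2 <;> omega
  · have e1 : (4 * m + 1) * k + c + y * (4 * m) = (4 * m + 1) * (k + y) + (c - y) := by
      zify [hcy]
      ring
    rw [e1, (dm _ _ (by omega)).1, (dm _ _ (by omega)).2] at h1
    rw [e2] at hx
    interval_cases y <;> interval_cases k <;> split_ifs at h1 h2 <;> omega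

/-! ### The upper bound for `(4m, 1)`: sliding blocks of four columns. -/

/-- `withValue n f` is `f n`; unfolding it evaluates `n` first. -/
def withValue {α : Type} : ℕ → (ℕ → α) → α
  | 0, f => f 0
  | n + 1, f => f n.succ

theorem withValue_eq {α : Type} (n : ℕ) (f : ℕ → α) : withValue n f = f n := by
  cases n <;> rfl

/-- Bits `i`, `j`, `k` of `u` are not all equal. -/
def bitsNotAllEqual (u i j k : ℕ) : Bool :=
  withValue (2 ^ i + 2 ^ j + 2 ^ k) fun m =>
    withValue (Nat.land u m) fun v => !(Nat.beq v 0) && !(Nat.beq v m)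

/-- A block of columns of four bits is coded by a number whose bit `4 c + r` is the entry in
row `r` of column `c`. This tests the triangles `(r, c - y), (r + y, c - y), (r + y, c)`. -/
def columnAdmissible (c u : ℕ) : Bool :=
  [1, 2, 3].all fun y => c < y || (List.range (4 - y)).all fun r =>
    bitsNotAllEqual u (4 * (c - y) + r) (4 * (c - y) + r + y) (4 * c + r + y)

/-- The admissible ways of writing a column `c` into the block `u`. -/
def appendColumn (c u : ℕ) : List ℕ :=
  withValue u fun u => (List.range 16).foldr (fun d l => withValue (u + d * 16 ^ c) fun v =>
    bif columnAdmissible c v then v :: l else l) []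

/-- The admissible blocks of four columns. -/
def blocks : List ℕ :=
  (((List.range 16).flatMap (appendColumn 1)).flatMap (appendColumn 2)).flatMap (appendColumn 3)

/-- The admissible blocks that can follow when a block of four columns moves by one column. -/
def shiftOne (l : List ℕ) : List ℕ := (l.map (· / 16)).flatMap (appendColumn 3)

/-- The union of two lists of natural numbers, omitting repetitions from the first. -/
def unionNew (l l' : List ℕ) : List ℕ :=
  l.foldr (fun u l => bif l.any (Nat.beq u) then l else u :: l) l'

def shiftFour (l : List ℕ) : List ℕ := unionNew (shiftOne (shiftOne (shiftOne (shiftOne l)))) []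

/-- Blocks reached from `l` by one, two or three moves by four columns. -/
def reach (l : List ℕ) : List ℕ :=
  (fun l₁ => unionNew (shiftFour (unionNew (shiftFour l₁) l₁)) l₁) (shiftFour l)

/-- Rows `1, 2, 3` of the block `u` are rows `0, 1, 2` of the block `v`. -/
def isRowShift (u v : ℕ) : Bool := Nat.beq (Nat.land (u / 2) 0x7777) (Nat.land v 0x7777)

/-- The blocks in `reach [u]` form a set closed under `shiftFour`, and none of them is a row
shift of `u`. -/
def orbitAvoidsRowShift (u : ℕ) : Bool :=
  (fun l => (shiftFour l).all (fun v => l.any (Nat.beq v)) && l.all fun v => !isRowShift u v)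
    (reach [u])

/-- The finite check, independent of `m`: closure under `shiftFour` covers any positive number of
moves by four columns. -/
theorem blocks_all_orbitAvoidsRowShift : blocks.all orbitAvoidsRowShift = true := by
  decide +kernel

theorem mem_unionNew {u : ℕ} {l l' : List ℕ} : u ∈ unionNew l l' ↔ u ∈ l ∨ u ∈ l' := by
  induction l with
  | nil => simp [unionNew]
  | cons a l ih =>
    have e : unionNew (a :: l) l' =
        bif (unionNew l l').any (Nat.beq a) then unionNew l l' else a :: unionNew l l' := rfl
    rw [e]
    cases h : (unionNew l l').any (Nat.beq a)
    · simp [ih, or_assoc]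
    · have ha : a ∈ unionNew l l' := by
        obtain ⟨b, hb, hab⟩ := List.any_eq_true.1 h
        rwa [Nat.eq_of_beq_eq_true hab]
      simp only [cond_true, List.mem_cons, ih] at ha ⊢
      constructor
      · tauto
      · rintro ((rfl | h) | h) <;> tauto

theorem mem_reach_of_mem_shiftFour {u : ℕ} {l : List ℕ} (h : u ∈ shiftFour l) : u ∈ reach l :=
  mem_unionNew.2 (Or.inr h)

theorem mem_reach_of_orbitAvoidsRowShift {u v : ℕ} (h : orbitAvoidsRowShift u = true)
    (hv : v ∈ shiftFour (reach [u])) : v ∈ reach [u] := by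
  simp only [orbitAvoidsRowShift, Bool.and_eq_true] at h
  obtain ⟨w, hw, e⟩ := List.any_eq_true.1 (List.all_eq_true.1 h.1 v hv)
  rwa [Nat.eq_of_beq_eq_true e]

theorem not_isRowShift_of_orbitAvoidsRowShift {u v : ℕ} (h : orbitAvoidsRowShift u = true)
    (hv : v ∈ reach [u]) : isRowShift u v = false := by
  simp only [orbitAvoidsRowShift, Bool.and_eq_true] at h
  simpa using List.all_eq_true.1 h.2 v hv

theorem mem_appendColumn {c u d : ℕ} (hd : d < 16) (h : columnAdmissible c (u + d * 16 ^ c)) :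
    u + d * 16 ^ c ∈ appendColumn c u := by
  rw [appendColumn, withValue_eq]
  simp only [withValue_eq]
  have : ∀ ds : List ℕ, d ∈ ds → u + d * 16 ^ c ∈ ds.foldr (fun d l =>
      bif columnAdmissible c (u + d * 16 ^ c) then (u + d * 16 ^ c) :: l else l) [] := by
    intro ds hds
    induction ds with
    | nil => simp at hds
    | cons a ds ih =>
      rw [List.foldr_cons]
      rcases List.mem_cons.1 hds with rfl | h'
      · rw [h]; simp
      · cases columnAdmissible c (u + a * 16 ^ c)
        · exact ih h'
        · exact List.mem_cons_of_mem _ (ih h')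
  exact this _ (List.mem_range.2 hd)

theorem bitsNotAllEqual_eq_true {u i j k : ℕ} (hi : (2 ^ i + 2 ^ j + 2 ^ k).testBit i = true)
    (hj : (2 ^ i + 2 ^ j + 2 ^ k).testBit j = true) (hk : (2 ^ i + 2 ^ j + 2 ^ k).testBit k = true)
    (h : ¬ (u.testBit i = u.testBit j ∧ u.testBit i = u.testBit k)) :
    bitsNotAllEqual u i j k = true := by
  rw [bitsNotAllEqual, withValue_eq, withValue_eq]
  generalize 2 ^ i + 2 ^ j + 2 ^ k = m at *
  have tb : ∀ l, (Nat.land u m).testBit l = (u.testBit l && m.testBit l) := fun l =>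
    Nat.testBit_and u m l
  have ti := tb i
  have tj := tb j
  have tk := tb k
  rw [hi, Bool.and_true] at ti
  rw [hj, Bool.and_true] at tj
  rw [hk, Bool.and_true] at tk
  rw [Bool.and_eq_true, Bool.not_eq_true', Bool.not_eq_true', ← Bool.not_eq_true,
    ← Bool.not_eq_true]
  -- A masked value `0` makes all three bits false; a masked value `m` makes them all true.
  constructor <;> intro e <;> replace e := Nat.eq_of_beq_eq_true e <;> apply h
  · rw [← ti, ← tj, ← tk, e]; simp
  · rw [← ti, ← tj, ← tk, e, hi, hj, hk]; simp

/-- The code of the columns `j, …, j + k - 1` of the array with entry `C (a r + c)` in row `r`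
and column `c`. -/
def blockCode (C : ℕ → Bool) (a k j : ℕ) : ℕ :=
  Nat.ofBits fun i : Fin (4 * k) => C (a * (i % 4) + (j + i / 4))

theorem testBit_blockCode (C : ℕ → Bool) (a : ℕ) {k : ℕ} (j : ℕ) {i : ℕ} (hi : i < 4 * k) :
    (blockCode C a k j).testBit i = C (a * (i % 4) + (j + i / 4)) :=
  Nat.testBit_ofBits_lt _ _ hi

theorem blockCode_lt (C : ℕ → Bool) (a k j : ℕ) : blockCode C a k j < 16 ^ k := by
  rw [show 16 = 2 ^ 4 by rfl, ← pow_mul]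
  exact Nat.ofBits_lt_two_pow _

theorem blockCode_succ (C : ℕ → Bool) (a k j : ℕ) :
    ∃ d < 16, blockCode C a (k + 1) j = blockCode C a k j + d * 16 ^ k := by
  refine ⟨blockCode C a (k + 1) j / 16 ^ k,
    Nat.div_lt_of_lt_mul (by simpa [pow_succ] using blockCode_lt C a (k + 1) j), ?_⟩
  have : blockCode C a k j = blockCode C a (k + 1) j % 16 ^ k := by
    rw [show 16 = 2 ^ 4 by rfl, ← pow_mul]
    refine Nat.eq_of_testBit_eq fun i => ?_
    rw [Nat.testBit_mod_two_pow]
    rcases lt_or_ge i (4 * k) with h | h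
    · rw [testBit_blockCode C a j h, testBit_blockCode C a j (by omega)]; simp [h]
    · rw [blockCode, Nat.testBit_ofBits_ge _ _ h]; simp [h.not_gt]
  rw [this, Nat.mod_add_div']

theorem blockCode_div (C : ℕ → Bool) (a k j : ℕ) :
    blockCode C a (k + 1) j / 16 = blockCode C a k (j + 1) := by
  rw [show 16 = 2 ^ 4 by rfl]
  refine Nat.eq_of_testBit_eq fun i => ?_
  rw [Nat.testBit_div_two_pow]
  rcases lt_or_ge i (4 * k) with h | h
  · rw [testBit_blockCode C a _ h, testBit_blockCode C a j (by omega)]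
    rw [show (i + 4) % 4 = i % 4 by omega, show j + (i + 4) / 4 = j + 1 + i / 4 by omega]
  · rw [blockCode, blockCode, Nat.testBit_ofBits_ge _ _ h, Nat.testBit_ofBits_ge _ _ (by omega)]

theorem columnAdmissible_blockCode {C : ℕ → Bool} {m : ℕ}
    (hC : AvoidsCopies (4 * m) 1 (4 * (4 * m + 1)) C) {k j : ℕ} (hk : k < 4)
    (hj : j + k < 4 * m + 4) : columnAdmissible k (blockCode C (4 * m) (k + 1) j) = true := by
  have key : ∀ y r, 0 < y → y ≤ k → r + y < 4 →
      ¬ ((blockCode C (4 * m) (k + 1) j).testBit (4 * (k - y) + r) =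
          (blockCode C (4 * m) (k + 1) j).testBit (4 * (k - y) + r + y) ∧
        (blockCode C (4 * m) (k + 1) j).testBit (4 * (k - y) + r) =
          (blockCode C (4 * m) (k + 1) j).testBit (4 * k + r + y)) := by
    intro y r hy hyk hr
    rw [testBit_blockCode _ _ _ (by omega), testBit_blockCode _ _ _ (by omega),
      testBit_blockCode _ _ _ (by omega)]
    rw [show (4 * (k - y) + r) % 4 = r by omega, show (4 * (k - y) + r) / 4 = k - y by omega,
      show (4 * (k - y) + r + y) % 4 = r + y by omega,
      show (4 * (k - y) + r + y) / 4 = k - y by omega,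
      show (4 * k + r + y) % 4 = r + y by omega, show (4 * k + r + y) / 4 = k by omega]
    have e : 4 * m * (r + y) = 4 * m * r + y * (4 * m) := by ring
    have e' : y * (4 * m + 1) = y * (4 * m) + y := by ring
    have hle : 4 * m * (r + y) ≤ 4 * m * 3 := Nat.mul_le_mul_left _ (by omega)
    -- Row `3`, column `4m + 3` is the point `16m + 3`, the last one in range.
    have := hC (4 * m * r + (j + (k - y))) y hy (by omega)
    rwa [show 4 * m * r + (j + (k - y)) + y * (4 * m) = 4 * m * (r + y) + (j + (k - y)) by omega,
      show 4 * m * r + (j + (k - y)) + y * (4 * m + 1) = 4 * m * (r + y) + (j + k) by omega]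
      at this
  generalize blockCode C (4 * m) (k + 1) j = u at key ⊢
  simp only [columnAdmissible, List.all_eq_true, Bool.or_eq_true, decide_eq_true_eq,
    List.mem_range]
  intro y hy
  rcases lt_or_ge k y with h | h
  · exact Or.inl h
  · refine Or.inr fun r hr => ?_
    have hy' : 0 < y := by simp at hy; omega
    have hu := key y r hy' h (by omega)
    clear key hC hj hy
    apply bitsNotAllEqual_eq_true _ _ _ hu <;> clear hu <;> interval_cases k <;>
      interval_cases y <;> interval_cases r <;> decide

theorem blockCode_mem_blocks {C : ℕ → Bool} {m : ℕ}
    (hC : AvoidsCopies (4 * m) 1 (4 * (4 * m + 1)) C) :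
    blockCode C (4 * m) 4 0 ∈ blocks := by
  have step : ∀ k < 4, blockCode C (4 * m) (k + 1) 0 ∈ appendColumn k (blockCode C (4 * m) k 0) := by
    intro k hk
    have hadm := columnAdmissible_blockCode hC (j := 0) hk (by omega)
    obtain ⟨d, hd, h⟩ := blockCode_succ C (4 * m) k 0
    rw [h] at hadm ⊢
    exact mem_appendColumn hd hadm
  exact List.mem_flatMap.2 ⟨_, List.mem_flatMap.2 ⟨_, List.mem_flatMap.2 ⟨_,
    List.mem_range.2 (blockCode_lt C (4 * m) 1 0), step 1 (by omega)⟩, step 2 (by omega)⟩,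
    step 3 (by omega)⟩

theorem blockCode_mem_shiftOne {C : ℕ → Bool} {m : ℕ}
    (hC : AvoidsCopies (4 * m) 1 (4 * (4 * m + 1)) C) {j : ℕ} (hj : j < 4 * m) {l : List ℕ}
    (hl : blockCode C (4 * m) 4 j ∈ l) : blockCode C (4 * m) 4 (j + 1) ∈ shiftOne l := by
  have hadm := columnAdmissible_blockCode hC (j := j + 1) (k := 3) (by omega) (by omega)
  obtain ⟨d, hd, h⟩ := blockCode_succ C (4 * m) 3 (j + 1)
  refine List.mem_flatMap.2 ⟨_, List.mem_map.2 ⟨_, hl, rfl⟩, ?_⟩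
  rw [blockCode_div]
  rw [h] at hadm ⊢
  exact mem_appendColumn hd hadm

theorem blockCode_mem_shiftFour {C : ℕ → Bool} {m : ℕ}
    (hC : AvoidsCopies (4 * m) 1 (4 * (4 * m + 1)) C) {j : ℕ} (hj : j < m) {l : List ℕ}
    (hl : blockCode C (4 * m) 4 (4 * j) ∈ l) :
    blockCode C (4 * m) 4 (4 * (j + 1)) ∈ shiftFour l := by
  rw [show 4 * (j + 1) = 4 * j + 1 + 1 + 1 + 1 by ring]
  exact mem_unionNew.2 <| Or.inl <| blockCode_mem_shiftOne hC (by omega) <|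
    blockCode_mem_shiftOne hC (by omega) <| blockCode_mem_shiftOne hC (by omega) <|
    blockCode_mem_shiftOne hC (by omega) hl

theorem isRowShift_blockCode (C : ℕ → Bool) (m : ℕ) :
    isRowShift (blockCode C (4 * m) 4 0) (blockCode C (4 * m) 4 (4 * m)) = true := by
  rw [isRowShift, Nat.beq_eq]
  refine Nat.eq_of_testBit_eq fun i => ?_
  refine (Nat.testBit_and _ _ i).trans (Eq.trans ?_ (Nat.testBit_and _ _ i).symm)
  rw [Nat.testBit_div_two]
  rcases lt_or_ge i 16 with hi | hi
  -- Row `3` is the top bit of each hexadecimal digit, which the mask `0x7777` deletes.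
  · by_cases h3 : i % 4 = 3
    · have : Nat.testBit 0x7777 i = false := by interval_cases i <;> simp at h3 <;> decide
      rw [this, Bool.and_false, Bool.and_false]
    · rw [testBit_blockCode _ _ _ (by omega), testBit_blockCode _ _ _ (by omega),
        show (i + 1) % 4 = i % 4 + 1 by omega, show (i + 1) / 4 = i / 4 by omega]
      congr 2
      ring
  · rw [Nat.testBit_lt_two_pow (lt_of_lt_of_le (by norm_num) (Nat.pow_le_pow_right two_pos hi)),
      Bool.and_false, Bool.and_false]

/-- In rows of length `4 m`, the end of each row continues as the beginning of the next one. -/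
theorem not_avoidsCopies_four_mul_one {m : ℕ} (hm : 0 < m) (C : ℕ → Bool) :
    ¬ AvoidsCopies (4 * m) 1 (4 * (4 * m + 1)) C := by
  intro hC
  have h := List.all_eq_true.1 blocks_all_orbitAvoidsRowShift _ (blockCode_mem_blocks hC)
  have hmem : ∀ k, k < m →
      blockCode C (4 * m) 4 (4 * (k + 1)) ∈ reach [blockCode C (4 * m) 4 0] := by
    intro k
    induction k with
    | zero =>
      exact fun hk => mem_reach_of_mem_shiftFour (blockCode_mem_shiftFour hC hk (by simp))
    | succ k ih =>
      exact fun hk => mem_reach_of_orbitAvoidsRowShift h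
        (blockCode_mem_shiftFour hC hk (ih (by omega)))
  have := not_isRowShift_of_orbitAvoidsRowShift h (hmem (m - 1) (by omega))
  rw [show 4 * (m - 1 + 1) = 4 * m by omega, isRowShift_blockCode] at this
  exact Bool.noConfusion this

/-! ### Case distinction and conclusion. -/

theorem exists_avoidsCopies_comm {s t L : ℕ} (h : ∃ C, AvoidsCopies s t L C) :
    ∃ C, AvoidsCopies t s L C :=
  let ⟨_, hC⟩ := h
  ⟨_, hC.reflect⟩

theorem exists_avoidsCopies {s t : ℕ} (hs : 0 < s) (ht : 0 < t) (hco : s.Coprime t)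
    (hne : ¬ ∃ m : ℕ, 0 < m ∧ (s = 4 * m * t ∨ t = 4 * m * s)) :
    ∃ C, AvoidsCopies s t (4 * (s + t)) C := by
  wlog hts : t ≤ s generalizing s t
  · rw [add_comm]
    refine exists_avoidsCopies_comm (this ht hs hco.symm ?_ (by omega))
    exact fun ⟨m, hm, h⟩ => hne ⟨m, hm, h.symm⟩
  have heven : ¬ (s % 2 = 0 ∧ t % 2 = 0) := fun ⟨h1, h2⟩ => by
    have := Nat.dvd_gcd (Nat.dvd_of_mod_eq_zero h1) (Nat.dvd_of_mod_eq_zero h2)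
    rw [hco] at this
    omega
  rcases Nat.even_or_odd (s + t) with h | h
  · rw [Nat.even_iff] at h
    exact exists_avoidsCopies_of_even (by omega) (by omega)
  · rw [Nat.odd_iff] at h
    rcases hts.eq_or_lt with rfl | hts
    · omega
    rcases Nat.lt_or_ge t 2 with h2 | h2
    · obtain rfl : t = 1 := by omega
      refine exists_avoidsCopies_of_mod_four ?_ rfl
      by_contra h4
      exact hne ⟨s / 4, by omega, Or.inl (by omega)⟩
    · exact exists_avoidsCopies_of_coprime hco h h2 hts

theorem mainTheorem4 :
    (∀ s t : ℕ, 0 < s → 0 < t →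
      (¬ ∃ m : ℕ, 0 < m ∧ (s = 4 * m * t ∨ t = 4 * m * s)) →
      homotheticVdW s t = 4 * (s + t) + 1) ∧
    (∀ m t : ℕ, 0 < m → 0 < t →
      (homotheticVdW (4 * m * t) t : ℤ) = 4 * (4 * m * t + t) - t + 1 ∧
      (homotheticVdW t (4 * m * t) : ℤ) = 4 * (4 * m * t + t) - t + 1) := by
  constructor
  · intro s t hs ht hne
    refine homotheticVdW_eq (not_avoidsCopies s t) ?_
    obtain ⟨g, a, b, hg, hco, rfl, rfl⟩ := Nat.exists_coprime' (Nat.gcd_pos_of_pos_left t hs)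
    have ha := Nat.pos_of_mul_pos_right hs
    have hb := Nat.pos_of_mul_pos_right ht
    obtain ⟨C, hC⟩ := exists_avoidsCopies ha hb hco fun ⟨m, hm, h⟩ => hne ⟨m, hm, by
      rcases h with rfl | rfl
      · left; ring
      · right; ring⟩
    have := hC.dilate hg
    rw [mul_comm g a, mul_comm g b, show g * (4 * (a + b)) = 4 * (a * g + b * g) by ring] at this
    exact ⟨_, this⟩
  · intro m t hm ht
    -- Here `t (16m + 3) = 4 (4mt + t) - t`.
    have hlow : ∃ C, AvoidsCopies (4 * m * t) t (t * (16 * m + 3)) C := by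
      obtain ⟨C, hC⟩ := exists_avoidsCopies_four_mul_one hm
      have := hC.dilate ht
      rw [mul_comm t, mul_one, show 4 * (4 * m + 1) - 1 = 16 * m + 3 by omega] at this
      exact ⟨_, this⟩
    have hup : ∀ C, ¬ AvoidsCopies (4 * m * t) t (t * (16 * m + 3) + 1) C := by
      intro C hC
      have h : AvoidsCopies (t * (4 * m)) (t * 1) (t * (16 * m + 3) + 1) C := by
        rwa [mul_comm t (4 * m), mul_one]
      have := h.contract
      rw [show 16 * m + 3 + 1 = 4 * (4 * m + 1) by ring] at this
      exact not_avoidsCopies_four_mul_one hm _ this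
    rw [homotheticVdW_eq hup hlow,
      homotheticVdW_eq (fun C hC => hup _ hC.reflect) (exists_avoidsCopies_comm hlow)]
    push_cast
    constructor <;> ring
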